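/- For $\alpha>0$ let $\mathcal H_\alpha(\mathbb C)=\{v\in H^\infty(\mathbb R,\mathbb C) : e^{\alpha|x|}|\partial_x^a v|\in L^\infty(\mathbb R)\text{ for every }a\in\mathbb N\}$, where $H^\infty=\bigcap_k H^k$, and let $\mathcal H_\alpha(\mathbb C^2)$ be the space of pairs of such functions. Let $h_1\in\mathbb R$ and $\lambda\in\mathbb C\setminus\{iy : y\in\mathbb R,\ |y|\ge h_1^2/4\}$. Then there is $\alpha_0>0$, depending only on $h_1$ and $\lambda$, such that the following holds. Let $\beta>0$, let $W_{1,1},W_{1,2},W_2,W_3,W_{4,1},W_{4,2}\in\mathcal H_\beta(\mathbb C)$, and let $L$ be the operator on $L^2(\mathbb R,\mathbb C^2)$ with domain $H^2(\mathbb R,\mathbb C^2)$ given by $$L=\begin{pmatrix} W_{1,1}+W_{1,2}\partial_x & \partial_{xx}-\frac{h_1^2}{4}+W_2\\ -\partial_{xx}+\frac{h_1^2}{4}+W_3 & W_{4,1}+W_{4,2}\partial_x\end{pmatrix}.$$ Then for every $\alpha$ with $0<\alpha\le\min\{\alpha_0,\beta\}$: (i) If $U=\begin{pmatrix}u\\ v\end{pmatrix}\in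 H^2(\mathbb R,\mathbb C^2)$ satisfies $LU=\lambda U$, then there is $C>0$ such that, for the $C^1$ representatives of $u$ and $v$, $$|u(x)|+|v(x)|+|u'(x)|+|v'(x)|\le Ce^{-\alpha|x|}\qquad\text{for all }x\in\mathbb R.$$ Moreover, $u,v\in\mathcal H_\alpha(\mathbb C)$. (ii) If $\lambda$ is not in the spectrum of $L$, then for every $A\in\mathcal H_\alpha(\mathbb C^2)$ there is $X\in\mathcal H_\alpha(\mathbb C^2)$ with $(L-\lambda\,\mathrm{Id})X=A$, and $X$ is the only solution in $H^2(\mathbb R,\mathbb C^2)$; that is, $(L-\lambda\,\mathrm{Id})^{-1}$ maps $\mathcal H_\alpha(\mathbb C^2)$ into itself. -/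

import Mathlib

open MeasureTheory
open scoped ENNReal ContDiff

namespace SystemDecay

noncomputable section

/-- The Hilbert space `L²(ℝ, ℂ)`. -/
abbrev L2 : Type := Lp ℂ 2 (volume : Measure ℝ)

/-- The Hilbert space `L²(ℝ, ℂ²)`, as the Hilbert sum of two copies of `L²(ℝ, ℂ)`. -/
abbrev L2C2 : Type := WithLp 2 (L2 × L2)

/-- `g` is the weak (distributional) derivative of `u`. -/
def HasWeakDeriv (u g : L2) : Prop :=
  ∀ φ : ℝ → ℝ, ContDiff ℝ ∞ φ → HasCompactSupport φ →
    ∫ x, deriv φ x • u x = -∫ x, φ x • g x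

theorem integrable_smul_L2 (u : L2) {φ : ℝ → ℝ} (hφ : Continuous φ)
    (hc : HasCompactSupport φ) : Integrable (fun x => φ x • u x) volume :=
  ((Lp.memLp u).locallyIntegrable (by norm_num)).integrable_smul_left_of_hasCompactSupport hφ hc

theorem HasWeakDeriv.add {u g v k : L2} (hu : HasWeakDeriv u g) (hv : HasWeakDeriv v k) :
    HasWeakDeriv (u + v) (g + k) := by
  intro φ hφ hc
  have hd : Continuous (deriv φ) := hφ.continuous_deriv (by simp)
  have e1 : ∫ x, deriv φ x • (u + v : L2) x = ∫ x, (deriv φ x • u x + deriv φ x • v x) := by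
    refine integral_congr_ae ?_
    filter_upwards [Lp.coeFn_add u v] with x hx
    rw [hx, Pi.add_apply, smul_add]
  have e2 : ∫ x, φ x • (g + k : L2) x = ∫ x, (φ x • g x + φ x • k x) := by
    refine integral_congr_ae ?_
    filter_upwards [Lp.coeFn_add g k] with x hx
    rw [hx, Pi.add_apply, smul_add]
  rw [e1, e2, integral_add (integrable_smul_L2 u hd hc.deriv) (integrable_smul_L2 v hd hc.deriv),
    integral_add (integrable_smul_L2 g hφ.continuous hc) (integrable_smul_L2 k hφ.continuous hc),
    hu φ hφ hc, hv φ hφ hc, neg_add]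

theorem HasWeakDeriv.smul {u g : L2} (c : ℂ) (hu : HasWeakDeriv u g) :
    HasWeakDeriv (c • u) (c • g) := by
  intro φ hφ hc
  have e1 : ∫ x, deriv φ x • (c • u : L2) x = ∫ x, c • (deriv φ x • u x) := by
    refine integral_congr_ae ?_
    filter_upwards [Lp.coeFn_smul c u] with x hx
    rw [hx, Pi.smul_apply, smul_comm]
  have e2 : ∫ x, φ x • (c • g : L2) x = ∫ x, c • (φ x • g x) := by
    refine integral_congr_ae ?_
    filter_upwards [Lp.coeFn_smul c g] with x hx
    rw [hx, Pi.smul_apply, smul_comm]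
  rw [e1, e2, integral_smul, integral_smul, hu φ hφ hc, smul_neg]

theorem hasWeakDeriv_zero : HasWeakDeriv 0 0 := by
  simpa using HasWeakDeriv.smul (u := 0) (g := 0) 0 (by
    intro φ hφ hc
    have h0 : ∀ ψ : ℝ → ℝ, ∫ x, ψ x • (0 : L2) x = 0 := fun ψ =>
      integral_eq_zero_of_ae (by
        filter_upwards with x
        simp)
    rw [h0, h0, neg_zero])

theorem HasWeakDeriv.unique {u g k : L2} (hg : HasWeakDeriv u g) (hk : HasWeakDeriv u k) :
    g = k := by
  refine Lp.ext ?_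
  refine ae_eq_of_integral_contDiff_smul_eq ((Lp.memLp g).locallyIntegrable (by norm_num))
    ((Lp.memLp k).locallyIntegrable (by norm_num)) ?_
  intro φ hφ hc
  exact neg_injective ((hg φ hφ hc).symm.trans (hk φ hφ hc))

open Classical in
/-- The weak derivative `∂ₓ u` in `L²`; it is meaningful for `u ∈ H¹`, and `0` by convention
if `u` has no weak derivative in `L²`. -/
def wderiv (u : L2) : L2 := if h : ∃ g, HasWeakDeriv u g then h.choose else 0

theorem HasWeakDeriv.wderiv_eq {u g : L2} (h : HasWeakDeriv u g) : wderiv u = g := by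
  have hex : ∃ g, HasWeakDeriv u g := ⟨g, h⟩
  rw [wderiv, dif_pos hex]
  exact hex.choose_spec.unique h

/-- The Sobolev space `H^k(ℝ, ℂ)`: weak derivatives up to order `k` exist and lie in `L²`. -/
def sobolev : ℕ → Submodule ℂ L2
  | 0 => ⊤
  | k + 1 =>
    { carrier := {u | ∃ g ∈ sobolev k, HasWeakDeriv u g}
      add_mem' := by
        rintro u v ⟨g, hg, hug⟩ ⟨k, hk, hvk⟩
        exact ⟨g + k, Submodule.add_mem _ hg hk, hug.add hvk⟩
      zero_mem' := ⟨0, Submodule.zero_mem _, hasWeakDeriv_zero⟩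
      smul_mem' := by
        rintro c u ⟨g, hg, hug⟩
        exact ⟨c • g, Submodule.smul_mem _ c hg, hug.smul c⟩ }

theorem sobolev_wderiv {k : ℕ} {u : L2} (hu : u ∈ sobolev (k + 1)) :
    HasWeakDeriv u (wderiv u) ∧ wderiv u ∈ sobolev k := by
  obtain ⟨g, hg, hug⟩ := hu
  rw [hug.wderiv_eq]
  exact ⟨hug, hg⟩

theorem wderiv_add {k : ℕ} {u v : L2} (hu : u ∈ sobolev (k + 1)) (hv : v ∈ sobolev (k + 1)) :
    wderiv (u + v) = wderiv u + wderiv v :=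
  ((sobolev_wderiv hu).1.add (sobolev_wderiv hv).1).wderiv_eq

theorem wderiv_smul {k : ℕ} {u : L2} (c : ℂ) (hu : u ∈ sobolev (k + 1)) :
    wderiv (c • u) = c • wderiv u :=
  ((sobolev_wderiv hu).1.smul c).wderiv_eq

/-- The space `𝓗(ℂ)` of weight `α`: the functions `v ∈ H^∞(ℝ, ℂ)` such that
`e^{α|x|} |∂ₓ^a v| ∈ L^∞(ℝ)` for every `a ∈ ℕ`. -/
def expSpace (α : ℝ) : Set L2 :=
  {v | (∀ k, v ∈ sobolev k) ∧
    ∀ a : ℕ, MemLp (fun x : ℝ => Real.exp (α * |x|) * ‖(wderiv^[a] v : L2) x‖) ∞ volume}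

/-- The space `𝓗(ℂ²)` of weight `α`. -/
def expSpaceC2 (α : ℝ) : Set L2C2 := {V | V.fst ∈ expSpace α ∧ V.snd ∈ expSpace α}

open Classical in
/-- Multiplication by `W` as a bounded operator on `L²(ℝ, ℂ)`; it is meaningful for essentially
bounded `W`, and `0` by convention otherwise. -/
def mulOp (W : L2) : L2 →L[ℂ] L2 :=
  if h : MemLp (fun x => W x) ∞ (volume : Measure ℝ) then
    (ContinuousLinearMap.mul ℂ ℂ).holderL volume ∞ 2 2 h.toLp else 0

theorem memLp_top_of_mem_expSpace {α : ℝ} (hα : 0 ≤ α) {W : L2} (hW : W ∈ expSpace α) :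
    MemLp (fun x => W x) ∞ (volume : Measure ℝ) := by
  refine MemLp.mono (hW.2 0) (Lp.aestronglyMeasurable W) (Filter.Eventually.of_forall fun x => ?_)
  have h1 : 1 ≤ Real.exp (α * |x|) := Real.one_le_exp (by positivity)
  simp only [Function.iterate_zero, id_eq, norm_mul, Real.norm_eq_abs, abs_norm, Real.abs_exp]
  nlinarith [norm_nonneg (W x)]

theorem mulOp_apply {α : ℝ} (hα : 0 ≤ α) {W : L2} (hW : W ∈ expSpace α) (u : L2) :
    ∀ᵐ x, mulOp W u x = W x * u x := by
  have h := memLp_top_of_mem_expSpace hα hW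
  rw [mulOp, dif_pos h]
  filter_upwards [(ContinuousLinearMap.mul ℂ ℂ).coeFn_holder (r := 2) h.toLp u, h.coeFn_toLp]
    with x hx hx'
  simpa [hx'] using hx

/-- The space `H²(ℝ, ℂ²)`, as a subspace of `L²(ℝ, ℂ²)`. -/
def sobolevTwoC2 : Submodule ℂ L2C2 where
  carrier := {U | U.fst ∈ sobolev 2 ∧ U.snd ∈ sobolev 2}
  add_mem' hU hV := ⟨Submodule.add_mem _ hU.1 hV.1, Submodule.add_mem _ hU.2 hV.2⟩
  zero_mem' := ⟨Submodule.zero_mem _, Submodule.zero_mem _⟩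
  smul_mem' c _ hU := ⟨Submodule.smul_mem _ c hU.1, Submodule.smul_mem _ c hU.2⟩

/-- The unbounded operator on `L²(ℝ, ℂ²)` with domain `H²(ℝ, ℂ²)` and matrix
`[[W₁₁ + W₁₂ ∂ₓ, ∂ₓₓ - h²/4 + W₂], [-∂ₓₓ + h²/4 + W₃, W₄₁ + W₄₂ ∂ₓ]]`. -/
def systemOp (h : ℝ) (W₁₁ W₁₂ W₂ W₃ W₄₁ W₄₂ : L2) : L2C2 →ₗ.[ℂ] L2C2 where
  domain := sobolevTwoC2
  toFun :=
    { toFun := fun U =>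
        let u : L2 := (U : L2C2).fst
        let v : L2 := (U : L2C2).snd
        WithLp.toLp 2
          ((mulOp W₁₁ u + mulOp W₁₂ (wderiv u))
              + (wderiv (wderiv v) - ((h ^ 2 / 4 : ℝ) : ℂ) • v + mulOp W₂ v),
            (-wderiv (wderiv u) + ((h ^ 2 / 4 : ℝ) : ℂ) • u + mulOp W₃ u)
              + (mulOp W₄₁ v + mulOp W₄₂ (wderiv v)))
      map_add' := by
        rintro ⟨U, hU⟩ ⟨V, hV⟩
        have e1 := wderiv_add hU.1 hV.1
        have e2 := wderiv_add hU.2 hV.2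
        have e3 := wderiv_add (sobolev_wderiv hU.1).2 (sobolev_wderiv hV.1).2
        have e4 := wderiv_add (sobolev_wderiv hU.2).2 (sobolev_wderiv hV.2).2
        rw [← WithLp.toLp_add]
        refine congrArg (WithLp.toLp 2) (Prod.ext ?_ ?_) <;>
          simp only [Submodule.coe_add, WithLp.add_fst, WithLp.add_snd, Prod.fst_add,
            Prod.snd_add, e1, e2, e3, e4, map_add, smul_add] <;> abel
      map_smul' := by
        rintro c ⟨U, hU⟩
        have e1 := wderiv_smul c hU.1
        have e2 := wderiv_smul c hU.2
        have e3 := wderiv_smul c (sobolev_wderiv hU.1).2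
        have e4 := wderiv_smul c (sobolev_wderiv hU.2).2
        rw [RingHom.id_apply, ← WithLp.toLp_smul]
        refine congrArg (WithLp.toLp 2) (Prod.ext ?_ ?_) <;>
          simp only [Submodule.coe_smul, WithLp.smul_fst, WithLp.smul_snd, Prod.smul_fst,
            Prod.smul_snd, e1, e2, e3, e4, map_smul, smul_add, smul_sub, smul_neg,
            smul_comm c ((h ^ 2 / 4 : ℝ) : ℂ)] }

/-- The spectrum of an unbounded operator `T`: the complement of the set of `z` such that
`T - z : D(T) → E` is bijective with bounded inverse. -/
def unboundedSpectrum {E : Type*} [NormedAddCommGroup E] [NormedSpace ℂ E]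
    (T : E →ₗ.[ℂ] E) : Set ℂ :=
  {z | ¬ (Function.Bijective (fun U : T.domain => T U - z • (U : E)) ∧
    ∃ C : ℝ, ∀ U : T.domain, ‖(U : E)‖ ≤ C * ‖T U - z • (U : E)‖)}

end

end SystemDecay

namespace SystemDecay

/-! Put `m = h₁² / 4` and write `(L - lam) U = A` with `U = (u, v)`, `A = (a, b)`. Solving the two
rows for the second derivatives and setting `p = u + iv`, `q = u - iv` decouples the
constant-coefficient part: `p'' = (m + i lam) p + r` and `q'' = (m - i lam) q + r̃`. The hypothesis
on `lam` says exactly that `m ± i lam` avoid `(-∞, 0]`, so they have square roots `k`, `l` with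
positive real part.

The remainders consist of `a`, `b` and products of a decaying coefficient with one of `u`, `v`,
`u'`, `v'`. These four are bounded because `U` is in `H²`, so the remainders are `O(e^{-α|x|})` at
once and no bootstrap in the rate is needed. Factoring `p'' - k² p` into first-order equations for
`p' + kp` and `p' - kp`, a bounded solution inherits the decay of `r` when `α < Re k`
(`norm_le_of_hasDerivAt_mul_add`, `exists_decay_of_second_order`). Higher derivatives follow by
differentiating the system (`expDecay_of_system`).

Both parts are this one statement (`exists_expDecay_of_systemOp_sub_smul`): (i) with `A = 0`, (ii)
with the `X` supplied by bijectivity of `L - lam`. -/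

/-! ### Primitives and the du Bois-Reymond lemma. -/

theorem absolutelyContinuousOnInterval_primitive {g : ℝ → ℂ}
    (hg : ∀ a b : ℝ, IntervalIntegrable g volume a b) {a b c : ℝ} (hc : c ∈ Set.uIcc a b) :
    AbsolutelyContinuousOnInterval (fun x => ∫ t in c..x, g t) a b := by
  have hre : ∀ a b : ℝ, IntervalIntegrable (fun x => (g x).re) volume a b := fun a b =>
    ⟨(hg a b).1.re, (hg a b).2.re⟩
  have him : ∀ a b : ℝ, IntervalIntegrable (fun x => (g x).im) volume a b := fun a b =>
    ⟨(hg a b).1.im, (hg a b).2.im⟩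
  have hconst : ∀ z : ℂ, AbsolutelyContinuousOnInterval (fun _ : ℝ => z) a b := fun z =>
    contDiffOn_const.absolutelyContinuousOnInterval
  -- The real-valued theorem is applied to the real and imaginary parts, recombined with the
  -- constants `1` and `I`.
  have h := (((hre a b).absolutelyContinuousOnInterval_intervalIntegral hc).smul (hconst 1)).add
    (((him a b).absolutelyContinuousOnInterval_intervalIntegral hc).smul (hconst Complex.I))
  convert! h using 1
  funext x
  simp only [Pi.add_apply, Pi.smul_apply']
  rw [← intervalIntegral.integral_smul_const, ← intervalIntegral.integral_smul_const,
    ← intervalIntegral.integral_add]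
  · refine intervalIntegral.integral_congr fun t _ => ?_
    simp only [Complex.real_smul, mul_one]
    exact (Complex.re_add_im _).symm
  · exact ⟨(hre c x).1.smul_const _, (hre c x).2.smul_const _⟩
  · exact ⟨(him c x).1.smul_const _, (him c x).2.smul_const _⟩

open Set in
/-- Integration by parts against the primitive of a locally integrable function. -/
theorem integral_deriv_smul_primitive {g : ℝ → ℂ} (hg : LocallyIntegrable g volume) {φ : ℝ → ℝ}
    (hφ : ContDiff ℝ ∞ φ) (hc : HasCompactSupport φ) :
    ∫ x, deriv φ x • (∫ t in (0 : ℝ)..x, g t) = -∫ x, φ x • g x := by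
  have hgi : ∀ a b : ℝ, IntervalIntegrable g volume a b := fun a b =>
    (hg.integrableOn_isCompact isCompact_uIcc).intervalIntegrable
  have hd : Continuous (deriv φ) := hφ.continuous_deriv (by simp)
  have hG : Continuous fun x => ∫ t in (0 : ℝ)..x, g t :=
    intervalIntegral.continuous_primitive hgi 0
  obtain ⟨R, hR⟩ := hc.isCompact.isBounded.subset_ball 0
  have hsub : Function.support φ ⊆ Ioo (-R) R := by
    refine (subset_tsupport φ).trans (hR.trans ?_)
    rw [Real.ball_eq_Ioo, zero_sub, zero_add]
  have hsub' : Function.support (deriv φ) ⊆ Ioo (-R) R := by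
    refine (support_deriv_subset).trans (hR.trans ?_)
    rw [Real.ball_eq_Ioo, zero_sub, zero_add]
  have hφL : φ (-R) = 0 := by
    by_contra h
    exact absurd (hsub h).1 (lt_irrefl _)
  have hφR : φ R = 0 := by
    by_contra h
    exact absurd (hsub h).2 (lt_irrefl _)
  have hint1 : Integrable (fun x => deriv φ x • ∫ t in (0 : ℝ)..x, g t) volume :=
    (hd.smul hG).integrable_of_hasCompactSupport hc.deriv.smul_right
  have hint2 : Integrable (fun x => φ x • g x) volume :=
    hg.integrable_smul_left_of_hasCompactSupport hφ.continuous hc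
  obtain ⟨k, hk⟩ : ∃ k : ℝ → ℂ, ∀ x, k x = (deriv φ x • ∫ t in (0 : ℝ)..x, g t) + φ x • g x :=
    ⟨_, fun _ => rfl⟩
  have hki : Integrable k volume := (hint1.add hint2).congr (.of_forall fun x => (hk x).symm)
  -- With `G` the primitive of `g`, `k` is the a.e. derivative of `φ G`. Subtracting the primitive
  -- of `k` from `φ G` leaves an absolutely continuous function with zero derivative a.e., hence a
  -- constant; `φ` vanishes at both endpoints.
  have hzero : ∫ x in (-R)..R, k x = 0 := by
    have hacφ : AbsolutelyContinuousOnInterval φ (-R) R :=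
      (hφ.of_le (by norm_cast)).contDiffOn.absolutelyContinuousOnInterval
    have hacG : AbsolutelyContinuousOnInterval (fun x => ∫ t in (0 : ℝ)..x, g t) (-R) R := by
      have h0 : (0 : ℝ) ∈ uIcc (-R) R := by
        rcases le_total 0 R with h | h
        · rw [uIcc_of_le (by linarith)]
          exact ⟨by linarith, h⟩
        · rw [uIcc_of_ge (by linarith)]
          exact ⟨h, by linarith⟩
      exact absolutelyContinuousOnInterval_primitive hgi h0
    have hack : AbsolutelyContinuousOnInterval (fun x => ∫ t in (-R)..x, k t) (-R) R :=
      absolutelyContinuousOnInterval_primitive (fun _ _ => hki.intervalIntegrable) left_mem_uIcc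
    have hac := (hacφ.smul hacG).sub hack
    have hder : ∀ᵐ x, x ∈ uIcc (-R) R → HasDerivAt
        ((φ • fun x => ∫ t in (0 : ℝ)..x, g t) - fun x => ∫ t in (-R)..x, k t) 0 x := by
      filter_upwards [LocallyIntegrable.ae_hasDerivAt_integral hg,
        LocallyIntegrable.ae_hasDerivAt_integral hki.locallyIntegrable] with x h1 h2 _
      have h3 := ((hφ.differentiable (by simp) x).hasDerivAt.smul (h1 0)).sub (h2 (-R))
      have h4 : φ x • g x + deriv φ x • (∫ t in (0 : ℝ)..x, g t) - k x = 0 := by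
        rw [hk]
        abel
      rwa [h4] at h3
    obtain ⟨C, hC⟩ := hac.const_of_ae_hasDerivAt_zero hder
    have h1 := hC (-R) (by simp)
    have h2 := hC R (by simp)
    simp only [Pi.sub_apply, Pi.smul_apply', hφL, hφR, zero_smul, intervalIntegral.integral_same, sub_zero,
      zero_sub] at h1 h2
    rw [← h1] at h2
    exact neg_eq_zero.mp h2
  have hsk : Function.support k ⊆ Ioc (-R) R := by
    intro x hx
    by_contra hxn
    have e1 : φ x = 0 := by
      by_contra h
      exact hxn (Ioo_subset_Ioc_self (hsub h))
    have e2 : deriv φ x = 0 := by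
      by_contra h
      exact hxn (Ioo_subset_Ioc_self (hsub' h))
    exact hx (by rw [hk, e1, e2, zero_smul, zero_smul, add_zero])
  rw [intervalIntegral.integral_eq_integral_of_support_subset hsk,
    integral_congr_ae (Filter.Eventually.of_forall hk), integral_add hint1 hint2] at hzero
  exact eq_neg_of_add_eq_zero_left hzero

open Set in
/-- A smooth compactly supported function of integral zero is the derivative of one. -/
theorem exists_deriv_eq_of_integral_eq_zero {θ : ℝ → ℝ} (hθ : ContDiff ℝ ∞ θ)
    (hc : HasCompactSupport θ) (h0 : ∫ x, θ x = 0) :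
    ∃ φ : ℝ → ℝ, ContDiff ℝ ∞ φ ∧ HasCompactSupport φ ∧ deriv φ = θ := by
  obtain ⟨R, hR⟩ := hc.isCompact.isBounded.subset_ball 0
  have hsub : Function.support θ ⊆ Ioo (-R) R := by
    refine (subset_tsupport θ).trans (hR.trans ?_)
    rw [Real.ball_eq_Ioo, zero_sub, zero_add]
  have hz : ∀ x, x ∉ Ioo (-R) R → θ x = 0 := fun x hx => by
    by_contra h
    exact hx (hsub h)
  have hder : ∀ x, HasDerivAt (fun x => ∫ t in (-R)..x, θ t) (θ x) x := fun x =>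
    intervalIntegral.integral_hasDerivAt_right (hθ.continuous.intervalIntegrable _ _)
      (hθ.continuous.stronglyMeasurableAtFilter _ _) hθ.continuous.continuousAt
  have hderiv : deriv (fun x => ∫ t in (-R)..x, θ t) = θ := funext fun x => (hder x).deriv
  refine ⟨fun x => ∫ t in (-R)..x, θ t, ?_, ?_, hderiv⟩
  · rw [contDiff_infty_iff_deriv, hderiv]
    exact ⟨fun x => (hder x).differentiableAt, hθ⟩
  · refine HasCompactSupport.intro (K := Icc (-R) R) isCompact_Icc fun x hx => ?_
    rcases lt_or_ge x (-R) with h | h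
    · rw [intervalIntegral.integral_symm, neg_eq_zero]
      refine intervalIntegral.integral_zero_ae (Filter.Eventually.of_forall fun t ht => hz t ?_)
      rw [uIoc_of_le h.le] at ht
      exact fun h' => absurd h'.1 (not_lt.mpr ht.2)
    · have hx2 : R < x := by
        by_contra h'
        exact hx ⟨h, not_lt.mp h'⟩
      rw [intervalIntegral.integral_eq_integral_of_support_subset, h0]
      exact hsub.trans fun t ht => ⟨ht.1, ht.2.le.trans hx2.le⟩

/-- The du Bois-Reymond lemma. -/
theorem ae_eq_const_of_integral_deriv_smul_eq_zero {w : ℝ → ℂ} (hw : LocallyIntegrable w volume)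
    (h : ∀ φ : ℝ → ℝ, ContDiff ℝ ∞ φ → HasCompactSupport φ → ∫ x, deriv φ x • w x = 0) :
    ∃ c : ℂ, ∀ᵐ x, w x = c := by
  let b : ContDiffBump (0 : ℝ) := default
  set η : ℝ → ℝ := b.normed volume with hη
  have hηc : HasCompactSupport η := b.hasCompactSupport_normed
  have hηd : ContDiff ℝ ∞ η := b.contDiff_normed
  have hη1 : ∫ x, η x = 1 := b.integral_normed
  refine ⟨∫ x, η x • w x, ?_⟩
  refine ae_eq_of_integral_contDiff_smul_eq hw (locallyIntegrable_const _) fun ψ hψ hψc => ?_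
  have hψi : Integrable ψ volume := hψ.continuous.integrable_of_hasCompactSupport hψc
  have hηi : Integrable η volume := hηd.continuous.integrable_of_hasCompactSupport hηc
  -- Removing the mean of `ψ` with the unit-mass bump `η` leaves a derivative of a test function.
  -- Testing `w` against it shows that `w` pairs with `ψ` like the constant `∫ η w`.
  obtain ⟨φ, hφ, hφc, hφd⟩ := exists_deriv_eq_of_integral_eq_zero
    (θ := fun x => ψ x - (∫ y, ψ y) * η x) (hψ.sub (contDiff_const.mul hηd))
    (by
      have := hψc.sub (hηc.mul_left (f := fun _ => ∫ y, ψ y))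
      exact this)
    (by rw [integral_sub hψi (hηi.const_mul _), integral_const_mul, hη1]; ring)
  have h1 := h φ hφ hφc
  have i1 : Integrable (fun x => ψ x • w x) volume :=
    hw.integrable_smul_left_of_hasCompactSupport hψ.continuous hψc
  have i2 : Integrable (fun x => η x • w x) volume :=
    hw.integrable_smul_left_of_hasCompactSupport hηd.continuous hηc
  have e : ∫ x, deriv φ x • w x = ∫ x, (ψ x • w x - (∫ y, ψ y) • (η x • w x)) := by
    congr 1
    funext x
    rw [hφd, sub_smul, mul_smul]
  have i3 : Integrable (fun x => (∫ y, ψ y) • (η x • w x)) volume := i2.smul (∫ y, ψ y)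
  rw [e, integral_sub i1 i3, integral_smul] at h1
  rw [sub_eq_zero.mp h1, integral_smul_const]

/-! ### Continuous and bounded representatives of Sobolev functions. -/

theorem L2.locallyIntegrable (u : L2) : LocallyIntegrable (fun x => u x) volume :=
  (Lp.memLp u).locallyIntegrable (by norm_num)

theorem L2.intervalIntegrable (u : L2) (a b : ℝ) : IntervalIntegrable (fun x => u x) volume a b :=
  ((L2.locallyIntegrable u).integrableOn_isCompact isCompact_uIcc).intervalIntegrable

/-- An `H¹` function has a continuous representative which is a primitive of its derivative. -/
theorem HasWeakDeriv.exists_primitive {u g : L2} (h : HasWeakDeriv u g) :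
    ∃ f : ℝ → ℂ, Continuous f ∧ (∀ᵐ x, u x = f x) ∧ ∀ x y, f y - f x = ∫ t in x..y, g t := by
  have hgi := L2.intervalIntegrable g
  have hG : Continuous fun x => ∫ t in (0 : ℝ)..x, g t :=
    intervalIntegral.continuous_primitive hgi 0
  obtain ⟨c, hcw⟩ := ae_eq_const_of_integral_deriv_smul_eq_zero
    (w := fun x => u x - ∫ t in (0 : ℝ)..x, g t)
    ((L2.locallyIntegrable u).sub hG.locallyIntegrable) fun φ hφ hc => by
      have hd : Continuous (deriv φ) := hφ.continuous_deriv (by simp)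
      simp only [smul_sub]
      rw [integral_sub (integrable_smul_L2 u hd hc.deriv), h φ hφ hc,
        integral_deriv_smul_primitive (L2.locallyIntegrable g) hφ hc, sub_self]
      exact (hd.smul hG).integrable_of_hasCompactSupport hc.deriv.smul_right
  refine ⟨fun x => c + ∫ t in (0 : ℝ)..x, g t, continuous_const.add hG, ?_, fun x y => ?_⟩
  · filter_upwards [hcw] with x hx
    rw [← hx]
    ring
  · rw [add_sub_add_left_eq_sub, intervalIntegral.integral_interval_sub_left (hgi _ _) (hgi _ _)]

/-- From `t ≤ 1 + t²`. What matters is that the bound does not depend on the unit window. -/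
theorem L2.intervalIntegral_norm_le (u : L2) (x : ℝ) :
    ∫ t in x..(x + 1), ‖u t‖ ≤ 1 + ∫ t, ‖u t‖ ^ 2 := by
  have hsq : Integrable (fun t => ‖u t‖ ^ 2) volume :=
    (memLp_two_iff_integrable_sq_norm (Lp.aestronglyMeasurable u)).mp (Lp.memLp u)
  have h1 : ∫ t in x..(x + 1), ‖u t‖ ≤ ∫ t in x..(x + 1), (1 + ‖u t‖ ^ 2) := by
    refine intervalIntegral.integral_mono_on (by linarith) (L2.intervalIntegrable u _ _).norm
      (intervalIntegrable_const.add hsq.intervalIntegrable) fun t _ => ?_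
    nlinarith [sq_nonneg (‖u t‖ - 1)]
  refine h1.trans ?_
  rw [intervalIntegral.integral_add intervalIntegrable_const hsq.intervalIntegrable]
  have h2 : ∫ t in x..(x + 1), ‖u t‖ ^ 2 ≤ ∫ t, ‖u t‖ ^ 2 := by
    rw [intervalIntegral.integral_of_le (by linarith)]
    exact setIntegral_le_integral hsq (Filter.Eventually.of_forall fun t => by positivity)
  simpa using h2

/-- A continuous `L²` function which is a primitive of an `L²` function is bounded. -/
theorem exists_bound_of_primitive {u g : L2} {f : ℝ → ℂ} (hf : Continuous f)
    (hu : ∀ᵐ x, u x = f x) (hfg : ∀ x y, f y - f x = ∫ t in x..y, g t) :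
    ∃ C, ∀ x, ‖f x‖ ≤ C := by
  refine ⟨(1 + ∫ t, ‖u t‖ ^ 2) + (1 + ∫ t, ‖g t‖ ^ 2), fun x => ?_⟩
  have hgn := (L2.intervalIntegrable g x (x + 1)).norm
  have h1 : ∀ y ∈ Set.Icc x (x + 1), ‖f x‖ ≤ ‖f y‖ + ∫ t in x..(x + 1), ‖g t‖ := by
    intro y hy
    have e : f x = f y - ∫ t in x..y, g t := by rw [← hfg]; ring
    have h2 : ‖∫ t in x..y, g t‖ ≤ ∫ t in x..(x + 1), ‖g t‖ :=
      (intervalIntegral.norm_integral_le_integral_norm hy.1).trans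
        (intervalIntegral.integral_mono_interval le_rfl hy.1 hy.2
          (Filter.Eventually.of_forall fun t => norm_nonneg _) hgn)
    rw [e]
    exact (norm_sub_le _ _).trans (by linarith)
  -- Averaging over `y` in a unit interval replaces the pointwise `‖f y‖` by an integral, which the
  -- `L²` norm controls.
  have h3 := intervalIntegral.integral_mono_on (μ := volume) (by linarith : x ≤ x + 1)
    intervalIntegrable_const ((hf.norm.intervalIntegrable _ _).add intervalIntegrable_const) h1
  rw [intervalIntegral.integral_add (hf.norm.intervalIntegrable _ _) intervalIntegrable_const]
    at h3
  have h4 : ∫ t in x..(x + 1), ‖f t‖ = ∫ t in x..(x + 1), ‖u t‖ :=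
    intervalIntegral.integral_congr_ae (by
      filter_upwards [hu] with t ht _
      rw [ht])
  rw [h4] at h3
  simp only [intervalIntegral.integral_const, add_sub_cancel_left, one_smul] at h3
  exact h3.trans (add_le_add (L2.intervalIntegral_norm_le u x) (L2.intervalIntegral_norm_le g x))

/-- The passage from weak to classical derivatives: once the weak derivative is known to agree a.e.
with a continuous function, the fundamental theorem of calculus applies. -/
theorem hasDerivAt_of_primitive {g f k : ℝ → ℂ} (hk : Continuous k) (hgk : ∀ᵐ x, g x = k x)
    (hfg : ∀ x y, f y - f x = ∫ t in x..y, g t) (x : ℝ) : HasDerivAt f (k x) x := by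
  have e : f = fun y => f 0 + ∫ t in (0 : ℝ)..y, k t := by
    funext y
    rw [← intervalIntegral.integral_congr_ae (hgk.mono fun t ht _ => ht), ← hfg]
    ring
  rw [e]
  exact (intervalIntegral.integral_hasDerivAt_right (hk.intervalIntegrable _ _)
      (hk.stronglyMeasurableAtFilter _ _) hk.continuousAt).const_add _

/-! ### Scalar equations: bounded solutions inherit the decay of the source. -/

open Filter Topology in
/-- The bounded solutions of `s' = k s + r` decay as fast as `r`, if `Re k` exceeds the rate. -/
theorem norm_le_of_hasDerivAt_mul_add {k : ℂ} {α C M : ℝ} (hα : 0 < α) (hk : α < k.re)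
    {s r : ℝ → ℂ} (hs : ∀ x, HasDerivAt s (k * s x + r x) x) (hM : ∀ x, ‖s x‖ ≤ M)
    (hr : ∀ x, ‖r x‖ ≤ C * Real.exp (-α * |x|)) (x : ℝ) :
    ‖s x‖ ≤ C / (k.re - α) * Real.exp (-α * |x|) := by
  have hC : 0 ≤ C := by
    have := (norm_nonneg _).trans (hr 0)
    simpa using this
  have hka : 0 < k.re - α := sub_pos.mpr hk
  have hk0 : 0 < k.re := hα.trans hk
  -- Integrating factor: `F' = e^{-kt} r`, and `F → 0` at `+∞` because `s` is bounded and `Re k >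
  -- 0`. So `F x` is controlled by integrating from `x` to `+∞`.
  set F : ℝ → ℂ := fun t => Complex.exp (-k * (t : ℂ)) * s t with hF
  have hnorm : ∀ t : ℝ, ‖Complex.exp (-k * (t : ℂ))‖ = Real.exp (-k.re * t) := fun t => by
    rw [Complex.norm_exp]
    simp
  have hFd : ∀ t : ℝ, HasDerivAt F (Complex.exp (-k * (t : ℂ)) * r t) t := fun t => by
    have h1 : HasDerivAt (fun t : ℝ => -k * (t : ℂ)) (-k * 1) t :=
      (HasDerivAt.ofReal_comp (hasDerivAt_id t)).const_mul _
    have h2 := h1.cexp.mul (hs t)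
    refine h2.congr_deriv ?_
    ring
  set D : ℝ := C / (k.re - α) * Real.exp (-α * |x| + α * (-x)) with hD
  have hD0 : 0 ≤ D := by positivity
  -- `B` vanishes at `x`, and `B'` dominates `‖F'‖` to the right of `x`, by `|x| ≤ |t| + (t - x)`.
  -- Its limit at `+∞` is finite because `α < Re k`.
  set B : ℝ → ℝ := fun t => D * (Real.exp (-(k.re - α) * x) - Real.exp (-(k.re - α) * t)) with hB
  have hBd : ∀ t, HasDerivAt B (C * Real.exp (-α * |x| + α * (-x)) * Real.exp (-(k.re - α) * t))
      t := fun t => by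
    have h1 : HasDerivAt (fun t : ℝ => -(k.re - α) * t) (-(k.re - α) * 1) t :=
      (hasDerivAt_id t).const_mul _
    have h2 := (h1.exp.const_sub (Real.exp (-(k.re - α) * x))).const_mul D
    refine h2.congr_deriv ?_
    rw [hD]
    field_simp
  have hbound : ∀ T, x ≤ T → ‖F x‖ ≤ ‖F T‖ + D * Real.exp (-(k.re - α) * x) := by
    intro T hT
    have h1 := image_norm_le_of_norm_deriv_right_le_deriv_boundary (a := x) (b := T)
      (f := fun t => F t - F x) (f' := fun t => Complex.exp (-k * (t : ℂ)) * r t) (B := B)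
      (fun t _ => ((hFd t).sub_const _).continuousAt.continuousWithinAt)
      (fun t _ => ((hFd t).sub_const _).hasDerivWithinAt) (by simp [hB]) hBd (by
        intro t ht
        rw [norm_mul, hnorm]
        have h3 : -α * |t| ≤ -α * |x| + α * (t - x) := by
          have : |x| ≤ |t| + (t - x) := by
            have := abs_sub_abs_le_abs_sub x t
            rw [abs_sub_comm, abs_of_nonneg (sub_nonneg.mpr ht.1)] at this
            linarith
          nlinarith
        calc Real.exp (-k.re * t) * ‖r t‖
            ≤ Real.exp (-k.re * t) * (C * Real.exp (-α * |x| + α * (t - x))) := by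
              gcongr
              exact (hr t).trans (by gcongr)
          _ = C * Real.exp (-α * |x| + α * (-x)) * Real.exp (-(k.re - α) * t) := by
              rw [mul_left_comm, mul_assoc, ← Real.exp_add, ← Real.exp_add]
              congr 2
              ring) (x := T) ⟨hT, le_rfl⟩
    have h2 : ‖F x‖ ≤ ‖F T‖ + ‖F T - F x‖ := by
      have := norm_sub_norm_le (F x) (F T)
      rw [norm_sub_rev] at this
      linarith
    have h4 : B T ≤ D * Real.exp (-(k.re - α) * x) := by
      rw [hB]
      exact mul_le_mul_of_nonneg_left (by linarith [Real.exp_pos (-(k.re - α) * T)]) hD0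
    linarith
  have hlim : Tendsto (fun T => M * Real.exp (-k.re * T) + D * Real.exp (-(k.re - α) * x)) atTop
      (𝓝 (M * 0 + D * Real.exp (-(k.re - α) * x))) := by
    refine (Tendsto.const_mul M ?_).add_const _
    refine Real.tendsto_exp_atBot.comp ?_
    exact tendsto_id.const_mul_atTop_of_neg (by linarith)
  have hFx : ‖F x‖ ≤ M * 0 + D * Real.exp (-(k.re - α) * x) := by
    refine ge_of_tendsto hlim ?_
    filter_upwards [eventually_ge_atTop x] with T hT
    refine (hbound T hT).trans ?_
    gcongr
    rw [hF, norm_mul, hnorm, mul_comm]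
    gcongr
    exact hM T
  rw [hF, norm_mul, hnorm] at hFx
  have e : M * 0 + D * Real.exp (-(k.re - α) * x)
      = Real.exp (-k.re * x) * (C / (k.re - α) * Real.exp (-α * |x|)) := by
    rw [hD, mul_zero, zero_add, mul_left_comm, mul_assoc, ← Real.exp_add, ← Real.exp_add]
    congr 2
    ring
  rw [e] at hFx
  exact le_of_mul_le_mul_left hFx (Real.exp_pos _)

/-- The bounded solutions of `p'' = k² p + r` decay as fast as `r`, together with `p'`, if `Re k`
exceeds the rate. -/
theorem exists_decay_of_second_order {k : ℂ} {α C M M₁ : ℝ} (hα : 0 < α) (hk : α < k.re)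
    {p p₁ r : ℝ → ℂ} (hp : ∀ x, HasDerivAt p (p₁ x) x)
    (hp₁ : ∀ x, HasDerivAt p₁ (k ^ 2 * p x + r x) x) (hM : ∀ x, ‖p x‖ ≤ M)
    (hM₁ : ∀ x, ‖p₁ x‖ ≤ M₁) (hr : ∀ x, ‖r x‖ ≤ C * Real.exp (-α * |x|)) :
    ∃ K, ∀ x, ‖p x‖ ≤ K * Real.exp (-α * |x|) ∧ ‖p₁ x‖ ≤ K * Real.exp (-α * |x|) := by
  have hk0 : 0 < k.re := hα.trans hk
  have hkne : k ≠ 0 := fun h => by simp [h] at hk0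
  have hs : ∀ x, ‖p₁ x + k * p x‖ ≤ C / (k.re - α) * Real.exp (-α * |x|) := by
    refine norm_le_of_hasDerivAt_mul_add (M := M₁ + ‖k‖ * M) (r := r) hα hk (fun x => ?_)
      (fun x => ?_) hr
    · refine ((hp₁ x).add ((hp x).const_mul k)).congr_deriv ?_
      ring
    · refine (norm_add_le _ _).trans (add_le_add (hM₁ x) ?_)
      rw [norm_mul]
      exact mul_le_mul_of_nonneg_left (hM x) (norm_nonneg _)
  -- `p' - kp` solves an equation with `-k`; reflecting `x ↦ -x` restores `k`, so the first-order
  -- lemma applies again.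
  have hd : ∀ x, ‖p₁ (-x) - k * p (-x)‖ ≤ C / (k.re - α) * Real.exp (-α * |x|) := by
    refine norm_le_of_hasDerivAt_mul_add (M := M₁ + ‖k‖ * M) (r := fun x => -r (-x)) hα hk
      (fun x => ?_) (fun x => ?_) (fun x => ?_)
    · have h1 : HasDerivAt (fun x => p₁ (-x)) ((-1 : ℝ) • (k ^ 2 * p (-x) + r (-x))) x :=
        (hp₁ (-x)).scomp x (hasDerivAt_neg x)
      have h2 : HasDerivAt (fun x => p (-x)) ((-1 : ℝ) • p₁ (-x)) x :=
        (hp (-x)).scomp x (hasDerivAt_neg x)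
      refine (h1.sub (h2.const_mul k)).congr_deriv ?_
      simp only [neg_smul, one_smul]
      ring
    · refine (norm_sub_le _ _).trans (add_le_add (hM₁ _) ?_)
      rw [norm_mul]
      exact mul_le_mul_of_nonneg_left (hM _) (norm_nonneg _)
    · rw [norm_neg]
      simpa using hr (-x)
  have hd' : ∀ x, ‖p₁ x - k * p x‖ ≤ C / (k.re - α) * Real.exp (-α * |x|) := fun x => by
    simpa using hd (-x)
  refine ⟨max (C / (k.re - α)) (C / (k.re - α) / ‖k‖), fun x => ⟨?_, ?_⟩⟩
  · refine le_trans ?_ (mul_le_mul_of_nonneg_right (le_max_right _ _) (Real.exp_pos _).le)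
    have e : p x = ((p₁ x + k * p x) - (p₁ x - k * p x)) / (2 * k) := by
      field_simp
      ring
    rw [e, norm_div, norm_mul, Complex.norm_ofNat, div_mul_eq_mul_div,
      div_le_div_iff₀ (by positivity) (by positivity)]
    nlinarith [norm_sub_le (p₁ x + k * p x) (p₁ x - k * p x), hs x, hd' x, norm_nonneg k]
  · refine le_trans ?_ (mul_le_mul_of_nonneg_right (le_max_left _ _) (Real.exp_pos _).le)
    have e : p₁ x = ((p₁ x + k * p x) + (p₁ x - k * p x)) / 2 := by ring
    rw [e, norm_div, Complex.norm_ofNat]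
    linarith [norm_add_le (p₁ x + k * p x) (p₁ x - k * p x), hs x, hd' x]

/-- The principal root works: its real part is `√((‖z‖ + Re z) / 2)`, and `‖z‖ + Re z > 0` off the
closed negative axis. -/
theorem exists_sq_eq_re_pos {z : ℂ} (hz : z ∈ Complex.slitPlane) :
    ∃ k : ℂ, k ^ 2 = z ∧ 0 < k.re := by
  refine ⟨z ^ (2⁻¹ : ℂ), ?_, ?_⟩
  · exact_mod_cast Complex.cpow_nat_inv_pow z two_ne_zero
  · rw [Complex.cpow_inv_two_re, Real.sqrt_pos]
    rcases Complex.mem_slitPlane_iff.mp hz with h | h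
    · linarith [norm_nonneg z]
    · linarith [Complex.abs_re_lt_norm.mpr h, neg_abs_le z.re]

/-! ### Calculus of exponentially decaying functions. -/

/-- `f` is bounded by a multiple of `e^{-α|x|}`. -/
def ExpBound (α : ℝ) (f : ℝ → ℂ) : Prop := ∃ C, ∀ x, ‖f x‖ ≤ C * Real.exp (-α * |x|)

/-- `f` is of class `C^n`, with all derivatives up to order `n` bounded by multiples of
`e^{-α|x|}`. -/
def ExpDecay (α : ℝ) : ℕ → (ℝ → ℂ) → Prop
  | 0, f => Continuous f ∧ ExpBound α f
  | n + 1, f => ExpBound α f ∧ ∃ f' : ℝ → ℂ, (∀ x, HasDerivAt f (f' x) x) ∧ ExpDecay α n f'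

section ExpBound

variable {α β : ℝ} {f g : ℝ → ℂ}

theorem ExpBound.add (hf : ExpBound α f) (hg : ExpBound α g) :
    ExpBound α fun x => f x + g x := by
  obtain ⟨C, hC⟩ := hf
  obtain ⟨D, hD⟩ := hg
  refine ⟨C + D, fun x => (norm_add_le _ _).trans ?_⟩
  rw [add_mul]
  exact add_le_add (hC x) (hD x)

theorem ExpBound.const_mul (c : ℂ) (hf : ExpBound α f) : ExpBound α fun x => c * f x := by
  obtain ⟨C, hC⟩ := hf
  refine ⟨‖c‖ * C, fun x => ?_⟩
  rw [norm_mul, mul_assoc]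
  exact mul_le_mul_of_nonneg_left (hC x) (norm_nonneg _)

theorem ExpBound.sub (hf : ExpBound α f) (hg : ExpBound α g) :
    ExpBound α fun x => f x - g x := by
  simpa [sub_eq_add_neg] using hf.add (hg.const_mul (-1))

/-- This makes the remainders decay before anything beyond boundedness is known about the solution.
-/
theorem ExpBound.mul_bounded {M : ℝ} (hf : ExpBound α f) (hg : ∀ x, ‖g x‖ ≤ M) :
    ExpBound α fun x => f x * g x := by
  obtain ⟨C, hC⟩ := hf
  refine ⟨C * M, fun x => ?_⟩
  rw [norm_mul, mul_right_comm]
  exact mul_le_mul (hC x) (hg x) (norm_nonneg _) ((norm_nonneg _).trans (hC x))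

theorem ExpBound.bounded (hα : 0 ≤ α) (hf : ExpBound α f) : ∃ M, ∀ x, ‖f x‖ ≤ M := by
  obtain ⟨C, hC⟩ := hf
  have hC0 : 0 ≤ C := by simpa using (norm_nonneg _).trans (hC 0)
  refine ⟨C, fun x => (hC x).trans (mul_le_of_le_one_right hC0 (Real.exp_le_one_iff.mpr ?_))⟩
  nlinarith [abs_nonneg x]

theorem ExpBound.mono (h : α ≤ β) (hf : ExpBound β f) : ExpBound α f := by
  obtain ⟨C, hC⟩ := hf
  have hC0 : 0 ≤ C := by simpa using (norm_nonneg _).trans (hC 0)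
  refine ⟨C, fun x => (hC x).trans ?_⟩
  gcongr

end ExpBound

namespace ExpDecay

variable {α β : ℝ} {n : ℕ} {f g : ℝ → ℂ}

theorem expBound (hf : ExpDecay α n f) : ExpBound α f := by
  cases n
  exacts [hf.2, hf.1]

theorem continuous (hf : ExpDecay α n f) : Continuous f := by
  cases n with
  | zero => exact hf.1
  | succ n =>
    obtain ⟨f', hf', -⟩ := hf.2
    exact continuous_iff_continuousAt.mpr fun x => (hf' x).continuousAt

theorem of_succ (hf : ExpDecay α (n + 1) f) : ExpDecay α n f := by
  induction n generalizing f with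
  | zero => exact ⟨hf.continuous, hf.expBound⟩
  | succ n ih =>
    obtain ⟨f', hf', h⟩ := hf.2
    exact ⟨hf.1, f', hf', ih h⟩

theorem mono (h : α ≤ β) (hf : ExpDecay β n f) : ExpDecay α n f := by
  induction n generalizing f with
  | zero => exact ⟨hf.1, hf.2.mono h⟩
  | succ n ih =>
    obtain ⟨f', hf', hd⟩ := hf.2
    exact ⟨hf.1.mono h, f', hf', ih hd⟩

theorem add (hf : ExpDecay α n f) (hg : ExpDecay α n g) : ExpDecay α n fun x => f x + g x := by
  induction n generalizing f g with
  | zero => exact ⟨hf.1.add hg.1, hf.2.add hg.2⟩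
  | succ n ih =>
    obtain ⟨f', hf', hd⟩ := hf.2
    obtain ⟨g', hg', he⟩ := hg.2
    exact ⟨hf.1.add hg.1, _, fun x => (hf' x).add (hg' x), ih hd he⟩

theorem const_mul (c : ℂ) (hf : ExpDecay α n f) : ExpDecay α n fun x => c * f x := by
  induction n generalizing f with
  | zero => exact ⟨continuous_const.mul hf.1, hf.2.const_mul c⟩
  | succ n ih =>
    obtain ⟨f', hf', hd⟩ := hf.2
    exact ⟨hf.1.const_mul c, _, fun x => (hf' x).const_mul c, ih hd⟩

theorem neg (hf : ExpDecay α n f) : ExpDecay α n fun x => -f x := by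
  simpa using hf.const_mul (-1)

theorem sub (hf : ExpDecay α n f) (hg : ExpDecay α n g) : ExpDecay α n fun x => f x - g x := by
  simpa [sub_eq_add_neg] using hf.add hg.neg

theorem mul (hα : 0 ≤ α) (hf : ExpDecay α n f) (hg : ExpDecay α n g) :
    ExpDecay α n fun x => f x * g x := by
  induction n generalizing f g with
  | zero =>
    obtain ⟨M, hM⟩ := hg.2.bounded hα
    exact ⟨hf.1.mul hg.1, hf.2.mul_bounded hM⟩
  | succ n ih =>
    obtain ⟨M, hM⟩ := hg.1.bounded hα
    obtain ⟨f', hf', hd⟩ := hf.2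
    obtain ⟨g', hg', he⟩ := hg.2
    exact ⟨hf.1.mul_bounded hM, _, fun x => (hf' x).mul (hg' x),
      (ih hd hg.of_succ).add (ih hf.of_succ he)⟩

end ExpDecay

/-! ### Weighted spaces versus classical decaying functions. -/

theorem integrable_exp_neg_mul_abs {c : ℝ} (hc : 0 < c) :
    Integrable (fun x : ℝ => Real.exp (-c * |x|)) volume := by
  have h1 : IntegrableOn (fun x : ℝ => Real.exp (-c * |x|)) (Set.Ioi 0) volume :=
    (integrableOn_exp_mul_Ioi (neg_neg_of_pos hc) 0).congr_fun
      (fun x hx => by rw [abs_of_pos hx]) measurableSet_Ioi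
  have h2 : IntegrableOn (fun x : ℝ => Real.exp (-c * |x|)) (Set.Iic 0) volume :=
    (integrableOn_exp_mul_Iic hc 0).congr_fun
      (fun x hx => by
        have hx' : x ≤ 0 := hx
        simp [abs_of_nonpos hx']) measurableSet_Iic
  rw [← integrableOn_univ, ← Set.Iic_union_Ioi (a := (0 : ℝ))]
  exact h2.union h1

theorem ExpDecay.memLp_two {α : ℝ} (hα : 0 < α) {n : ℕ} {f : ℝ → ℂ} (hf : ExpDecay α n f) :
    MemLp f 2 volume := by
  rw [memLp_two_iff_integrable_sq_norm hf.continuous.aestronglyMeasurable]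
  obtain ⟨C, hC⟩ := hf.expBound
  refine ((integrable_exp_neg_mul_abs (mul_pos two_pos hα)).const_mul (C ^ 2)).mono'
    (hf.continuous.norm.pow 2).aestronglyMeasurable (Filter.Eventually.of_forall fun x => ?_)
  rw [Real.norm_of_nonneg (by positivity)]
  refine (pow_le_pow_left₀ (norm_nonneg _) (hC x) 2).trans (le_of_eq ?_)
  rw [mul_pow, ← Real.exp_nat_mul]
  congr 2
  push_cast
  ring

/-- A classical derivative is a weak derivative. -/
theorem hasWeakDeriv_of_hasDerivAt {u g : L2} {f f' : ℝ → ℂ} (hf : ∀ x, HasDerivAt f (f' x) x)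
    (hf' : Continuous f') (hu : ∀ᵐ x, u x = f x) (hg : ∀ᵐ x, g x = f' x) : HasWeakDeriv u g := by
  intro φ hφ hc
  have hd : Continuous (deriv φ) := hφ.continuous_deriv (by simp)
  have hfc : Continuous f := continuous_iff_continuousAt.mpr fun x => (hf x).continuousAt
  have e1 : ∫ x, deriv φ x • u x = ∫ x, deriv φ x • f x :=
    integral_congr_ae (hu.mono fun x hx => by simp only [hx])
  have e2 : ∫ x, φ x • g x = ∫ x, φ x • f' x :=
    integral_congr_ae (hg.mono fun x hx => by simp only [hx])
  have h := integral_bilinear_hasDerivAt_right_eq_neg_left_of_integrable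
    (L := ContinuousLinearMap.lsmul ℝ ℝ) (u := φ) (u' := deriv φ) (v := f) (v' := f')
    (fun x _ => (hφ.differentiable (by simp) x).hasDerivAt) (fun x _ => hf x)
    ((hφ.continuous.smul hf').integrable_of_hasCompactSupport hc.smul_right)
    ((hd.smul hfc).integrable_of_hasCompactSupport hc.deriv.smul_right)
    ((hφ.continuous.smul hfc).integrable_of_hasCompactSupport hc.smul_right)
  simp only [ContinuousLinearMap.lsmul_apply] at h
  rw [e1, e2, h, neg_neg]

theorem ExpDecay.exists_hasWeakDeriv {α : ℝ} (hα : 0 < α) {n : ℕ} {f : ℝ → ℂ}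
    (hf : ExpDecay α (n + 1) f) {u : L2} (hu : ∀ᵐ x, u x = f x) :
    ∃ (f' : ℝ → ℂ) (g : L2), (∀ x, HasDerivAt f (f' x) x) ∧ (∀ᵐ x, g x = f' x) ∧
      HasWeakDeriv u g ∧ ExpDecay α n f' := by
  obtain ⟨f', hf', hd⟩ := hf.2
  have hg := (hd.memLp_two hα).coeFn_toLp
  exact ⟨f', (hd.memLp_two hα).toLp, hf', hg,
    hasWeakDeriv_of_hasDerivAt hf' hd.continuous hu hg, hd⟩

theorem ExpDecay.mem_sobolev {α : ℝ} (hα : 0 < α) {n : ℕ} {f : ℝ → ℂ} (hf : ExpDecay α n f)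
    {u : L2} (hu : ∀ᵐ x, u x = f x) : u ∈ sobolev n := by
  induction n generalizing f u with
  | zero => exact Submodule.mem_top
  | succ n ih =>
    obtain ⟨f', g, -, hg, hw, hd⟩ := hf.exists_hasWeakDeriv hα hu
    exact ⟨g, ih hd hg, hw⟩

theorem ExpDecay.memLp_top {α : ℝ} {f : ℝ → ℂ} (a : ℕ) (hα : 0 < α) (hf : ExpDecay α a f)
    {u : L2} (hu : ∀ᵐ x, u x = f x) :
    MemLp (fun x : ℝ => Real.exp (α * |x|) * ‖(wderiv^[a] u : L2) x‖) ∞ volume := by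
  induction a generalizing f u with
  | zero =>
    obtain ⟨C, hC⟩ := hf.expBound
    have hcont : Continuous fun x : ℝ => Real.exp (α * |x|) := by fun_prop
    refine memLp_top_of_bound
      (hcont.aestronglyMeasurable.mul (Lp.aestronglyMeasurable _).norm) C ?_
    filter_upwards [hu] with x hx
    rw [Real.norm_of_nonneg (by positivity), Function.iterate_zero, id_eq, hx]
    refine (mul_le_mul_of_nonneg_left (hC x) (Real.exp_pos _).le).trans (le_of_eq ?_)
    rw [mul_left_comm, ← Real.exp_add, neg_mul, add_neg_cancel, Real.exp_zero, mul_one]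
  | succ a ih =>
    obtain ⟨f', g, -, hg, hw, hd⟩ := hf.exists_hasWeakDeriv hα hu
    have := ih hd hg
    rwa [Function.iterate_succ_apply, hw.wderiv_eq]

theorem mem_expSpace_of_expDecay {α : ℝ} (hα : 0 < α) {f : ℝ → ℂ} (hf : ∀ n, ExpDecay α n f)
    {u : L2} (hu : ∀ᵐ x, u x = f x) : u ∈ expSpace α :=
  ⟨fun k => (hf k).mem_sobolev hα hu, fun a => (hf a).memLp_top a hα hu⟩

theorem wderiv_mem_expSpace {α : ℝ} {u : L2} (hu : u ∈ expSpace α) : wderiv u ∈ expSpace α :=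
  ⟨fun k => (sobolev_wderiv (hu.1 (k + 1))).2, fun a => by
    have := hu.2 (a + 1)
    rwa [Function.iterate_succ] at this⟩

/-- An essential bound on a continuous function holds everywhere: the set where it holds is closed,
and dense because its complement is null. -/
theorem expBound_of_mem_expSpace {α : ℝ} {u : L2} (hu : u ∈ expSpace α) {f : ℝ → ℂ}
    (hf : Continuous f) (huf : ∀ᵐ x, u x = f x) : ExpBound α f := by
  obtain ⟨C, hC⟩ : ∃ C : ℝ, ∀ᵐ x, ‖Real.exp (α * |x|) * ‖u x‖‖ ≤ C :=
    ⟨_, ae_le_lpNorm_exponent_top (hu.2 0)⟩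
  refine ⟨C, fun x => ?_⟩
  have hae : ∀ᵐ x, Real.exp (α * |x|) * ‖f x‖ ≤ C := by
    filter_upwards [hC, huf] with x hx hxf
    rw [← hxf]
    exact (le_abs_self _).trans hx
  have hcl : IsClosed {x : ℝ | Real.exp (α * |x|) * ‖f x‖ ≤ C} :=
    isClosed_le (by fun_prop) continuous_const
  have hx : Real.exp (α * |x|) * ‖f x‖ ≤ C := by
    have hd : Dense {x : ℝ | Real.exp (α * |x|) * ‖f x‖ ≤ C} := Measure.dense_of_ae hae
    have := hd x
    rwa [hcl.closure_eq] at this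
  rw [neg_mul, Real.exp_neg, ← div_eq_mul_inv, le_div_iff₀ (Real.exp_pos _), mul_comm]
  exact hx

/-- The elements of the weighted space have a representative with exponentially decaying
derivatives. -/
theorem exists_expDecay_of_mem_expSpace {α : ℝ} {u : L2} (hu : u ∈ expSpace α) :
    ∃ f : ℝ → ℂ, (∀ᵐ x, u x = f x) ∧ ∀ n, ExpDecay α n f := by
  obtain ⟨f, hfc, hf, -⟩ := (sobolev_wderiv (hu.1 1)).1.exists_primitive
  refine ⟨f, hf, fun n => ?_⟩
  induction n generalizing f u with
  | zero => exact ⟨hfc, expBound_of_mem_expSpace hu hfc hf⟩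
  | succ n ih =>
    have hw := wderiv_mem_expSpace hu
    obtain ⟨k, hkc, hk, -⟩ := (sobolev_wderiv (hw.1 1)).1.exists_primitive
    -- The induction carries an arbitrary continuous representative `f`. Two continuous
    -- representatives coincide, so `f` is the one that is a primitive of `wderiv u`.
    obtain ⟨f₀, hf₀c, hf₀, hprim⟩ := (sobolev_wderiv (hu.1 1)).1.exists_primitive
    have he : f = f₀ := by
      refine (Continuous.ae_eq_iff_eq volume hfc hf₀c).mp ?_
      filter_upwards [hf, hf₀] with x h1 h2
      rw [← h1, h2]
    subst he
    exact ⟨expBound_of_mem_expSpace hu hfc hf, k, hasDerivAt_of_primitive hkc hk hprim,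
      ih hw k hkc hk⟩

/-! ### Decay for the classical system. -/

section System

variable {α : ℝ} {m lam k l : ℂ} {w₁₁ w₁₂ w₂ w₃ w₄₁ w₄₂ a b u v u' v' : ℝ → ℂ}

/-- First-order decay for bounded solutions of the classical system: `u + iv` and `u - iv` satisfy
scalar equations `p'' = (m ± i lam) p + r` with exponentially decaying `r`. -/
theorem expBound_of_system (hα : 0 < α) (hk : k ^ 2 = m + Complex.I * lam)
    (hl : l ^ 2 = m - Complex.I * lam) (hαk : α < k.re) (hαl : α < l.re)
    (hw₁₁ : ExpBound α w₁₁) (hw₁₂ : ExpBound α w₁₂) (hw₂ : ExpBound α w₂) (hw₃ : ExpBound α w₃)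
    (hw₄₁ : ExpBound α w₄₁) (hw₄₂ : ExpBound α w₄₂) (ha : ExpBound α a) (hb : ExpBound α b)
    (hu : ∀ x, HasDerivAt u (u' x) x) (hv : ∀ x, HasDerivAt v (v' x) x)
    (hu' : ∀ x, HasDerivAt u'
      (m * u x - lam * v x + (w₃ x * u x + w₄₁ x * v x + w₄₂ x * v' x - b x)) x)
    (hv' : ∀ x, HasDerivAt v'
      (lam * u x + m * v x + (a x - w₂ x * v x - w₁₁ x * u x - w₁₂ x * u' x)) x)
    (bu : ∃ M, ∀ x, ‖u x‖ ≤ M) (bv : ∃ M, ∀ x, ‖v x‖ ≤ M)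
    (bu' : ∃ M, ∀ x, ‖u' x‖ ≤ M) (bv' : ∃ M, ∀ x, ‖v' x‖ ≤ M) :
    ExpBound α u ∧ ExpBound α v ∧ ExpBound α u' ∧ ExpBound α v' := by
  obtain ⟨Mu, hMu⟩ := bu
  obtain ⟨Mv, hMv⟩ := bv
  obtain ⟨Mu', hMu'⟩ := bu'
  obtain ⟨Mv', hMv'⟩ := bv'
  have hR₁ := (((hw₃.mul_bounded hMu).add (hw₄₁.mul_bounded hMv)).add
    (hw₄₂.mul_bounded hMv')).sub hb
  have hR₂ := ((ha.sub (hw₂.mul_bounded hMv)).sub (hw₁₁.mul_bounded hMu)).sub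
    (hw₁₂.mul_bounded hMu')
  -- Both combinations are treated at once with `c = ±I`: since `-lam v = c² lam v`, the constant
  -- part of `u'' + c v''` is `(m + c lam)(u + c v)`.
  have key : ∀ (c κ : ℂ), c ^ 2 = -1 → κ ^ 2 = m + c * lam → α < κ.re →
      ExpBound α (fun x => u x + c * v x) ∧ ExpBound α (fun x => u' x + c * v' x) := by
    intro c κ hc hκ hακ
    have bd : ∀ {f g : ℝ → ℂ} {M N : ℝ}, (∀ x, ‖f x‖ ≤ M) → (∀ x, ‖g x‖ ≤ N) →
        ∀ x, ‖f x + c * g x‖ ≤ M + ‖c‖ * N := fun hf hg x => by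
      refine (norm_add_le _ _).trans (add_le_add (hf x) ?_)
      rw [norm_mul]
      exact mul_le_mul_of_nonneg_left (hg x) (norm_nonneg _)
    obtain ⟨C, hC⟩ := hR₁.add (hR₂.const_mul c)
    obtain ⟨K, hK⟩ := exists_decay_of_second_order hα hακ
      (fun x => (hu x).add ((hv x).const_mul c))
      (fun x => ((hu' x).add ((hv' x).const_mul c)).congr_deriv (by
        simp only [Pi.add_apply, hκ]
        linear_combination (-lam * v x) * hc)) (bd hMu hMv) (bd hMu' hMv') hC
    exact ⟨⟨K, fun x => (hK x).1⟩, ⟨K, fun x => (hK x).2⟩⟩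
  obtain ⟨hp, hp'⟩ := key Complex.I k Complex.I_sq hk hαk
  obtain ⟨hq, hq'⟩ := key (-Complex.I) l (by simp) (by rw [hl]; ring) hαl
  have split : ∀ {f g : ℝ → ℂ}, ExpBound α (fun x => f x + Complex.I * g x) →
      ExpBound α (fun x => f x + -Complex.I * g x) → ExpBound α f ∧ ExpBound α g := by
    intro f g h₁ h₂
    have e₁ := (h₁.add h₂).const_mul (1 / 2)
    have e₂ := (h₁.sub h₂).const_mul (-Complex.I / 2)
    refine ⟨?_, ?_⟩
    · convert! e₁ using 2
      ring
    · convert! e₂ using 2 with x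
      linear_combination (g x) * Complex.I_sq
  exact ⟨(split hp hq).1, (split hp hq).2, (split hp' hq').1, (split hp' hq').2⟩

/-- Bounded classical solutions of the system decay exponentially with all their derivatives. -/
theorem expDecay_of_system (hα : 0 < α) (hk : k ^ 2 = m + Complex.I * lam)
    (hl : l ^ 2 = m - Complex.I * lam) (hαk : α < k.re) (hαl : α < l.re)
    (hw₁₁ : ∀ n, ExpDecay α n w₁₁) (hw₁₂ : ∀ n, ExpDecay α n w₁₂) (hw₂ : ∀ n, ExpDecay α n w₂)
    (hw₃ : ∀ n, ExpDecay α n w₃) (hw₄₁ : ∀ n, ExpDecay α n w₄₁) (hw₄₂ : ∀ n, ExpDecay α n w₄₂)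
    (ha : ∀ n, ExpDecay α n a) (hb : ∀ n, ExpDecay α n b)
    (hu : ∀ x, HasDerivAt u (u' x) x) (hv : ∀ x, HasDerivAt v (v' x) x)
    (hu' : ∀ x, HasDerivAt u'
      (m * u x - lam * v x + (w₃ x * u x + w₄₁ x * v x + w₄₂ x * v' x - b x)) x)
    (hv' : ∀ x, HasDerivAt v'
      (lam * u x + m * v x + (a x - w₂ x * v x - w₁₁ x * u x - w₁₂ x * u' x)) x)
    (bu : ∃ M, ∀ x, ‖u x‖ ≤ M) (bv : ∃ M, ∀ x, ‖v x‖ ≤ M)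
    (bu' : ∃ M, ∀ x, ‖u' x‖ ≤ M) (bv' : ∃ M, ∀ x, ‖v' x‖ ≤ M) (n : ℕ) :
    ExpDecay α n u ∧ ExpDecay α n v ∧ ExpDecay α n u' ∧ ExpDecay α n v' := by
  obtain ⟨eu, ev, eu', ev'⟩ := expBound_of_system hα hk hl hαk hαl (hw₁₁ 0).2 (hw₁₂ 0).2 (hw₂ 0).2
    (hw₃ 0).2 (hw₄₁ 0).2 (hw₄₂ 0).2 (ha 0).2 (hb 0).2 hu hv hu' hv' bu bv bu' bv'
  -- The first-order bounds are settled, so only regularity is left. `u'` and `v'` are carried at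
  -- the same order as `u` and `v`, because the right-hand sides contain them through `w₄₂` and
  -- `w₁₂`.
  induction n with
  | zero =>
    have cont : ∀ {f g : ℝ → ℂ}, (∀ x, HasDerivAt f (g x) x) → Continuous f := fun h =>
      continuous_iff_continuousAt.mpr fun x => (h x).continuousAt
    exact ⟨⟨cont hu, eu⟩, ⟨cont hv, ev⟩, ⟨cont hu', eu'⟩, ⟨cont hv', ev'⟩⟩
  | succ n ih =>
    obtain ⟨du, dv, du', dv'⟩ := ih
    refine ⟨⟨eu, u', hu, du'⟩, ⟨ev, v', hv, dv'⟩, ⟨eu', _, hu', ?_⟩, ⟨ev', _, hv', ?_⟩⟩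
    · exact ((du.const_mul m).sub (dv.const_mul lam)).add
        (((((hw₃ n).mul hα.le du).add ((hw₄₁ n).mul hα.le dv)).add
          ((hw₄₂ n).mul hα.le dv')).sub (hb n))
    · exact ((du.const_mul lam).add (dv.const_mul m)).add
        ((((ha n).sub ((hw₂ n).mul hα.le dv)).sub ((hw₁₁ n).mul hα.le du)).sub
          ((hw₁₂ n).mul hα.le du'))

end System

/-! ### From the operator equation to the classical system. -/

/-- An `H²` function has a representative `f` of class `C¹`; `f` and its derivative are bounded. -/
theorem exists_rep_of_mem_sobolev_two {u : L2} (hu : u ∈ sobolev 2) :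
    ∃ f f' : ℝ → ℂ, (∀ᵐ x, u x = f x) ∧ (∀ᵐ x, wderiv u x = f' x) ∧ (∀ x, HasDerivAt f (f' x) x) ∧
      Continuous f' ∧ (∀ x y, f' y - f' x = ∫ t in x..y, wderiv (wderiv u) t) ∧
      (∃ M, ∀ x, ‖f x‖ ≤ M) ∧ ∃ M, ∀ x, ‖f' x‖ ≤ M := by
  obtain ⟨h₁, h₁'⟩ := sobolev_wderiv hu
  obtain ⟨h₂, -⟩ := sobolev_wderiv h₁'
  obtain ⟨f, hfc, hf, hfp⟩ := h₁.exists_primitive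
  obtain ⟨f', hfc', hf', hfp'⟩ := h₂.exists_primitive
  exact ⟨f, f', hf, hf', hasDerivAt_of_primitive hfc' hf' hfp, hfc', hfp',
    exists_bound_of_primitive hfc hf hfp, exists_bound_of_primitive hfc' hf' hfp'⟩

/-- The solutions of `(L - lam) U = A` with exponentially decaying `A` have exponentially
decaying classical representatives. -/
theorem exists_expDecay_of_systemOp_sub_smul {h₁ : ℝ} {lam k l : ℂ} {α : ℝ} (hα : 0 < α)
    (hk : k ^ 2 = ((h₁ ^ 2 / 4 : ℝ) : ℂ) + Complex.I * lam)
    (hl : l ^ 2 = ((h₁ ^ 2 / 4 : ℝ) : ℂ) - Complex.I * lam) (hαk : α < k.re) (hαl : α < l.re)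
    {W₁₁ W₁₂ W₂ W₃ W₄₁ W₄₂ : L2} {β : ℝ} (hαβ : α ≤ β)
    (hW₁₁ : W₁₁ ∈ expSpace β) (hW₁₂ : W₁₂ ∈ expSpace β) (hW₂ : W₂ ∈ expSpace β)
    (hW₃ : W₃ ∈ expSpace β) (hW₄₁ : W₄₁ ∈ expSpace β) (hW₄₂ : W₄₂ ∈ expSpace β)
    {A : L2C2} (hA : A ∈ expSpaceC2 α) (U : (systemOp h₁ W₁₁ W₁₂ W₂ W₃ W₄₁ W₄₂).domain)
    (hU : systemOp h₁ W₁₁ W₁₂ W₂ W₃ W₄₁ W₄₂ U - lam • (U : L2C2) = A) :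
    ∃ u v : ℝ → ℂ, (∀ᵐ x, (U : L2C2).fst x = u x) ∧ (∀ᵐ x, (U : L2C2).snd x = v x) ∧
      (∀ n, ExpDecay α n u) ∧ ∀ n, ExpDecay α n v := by
  obtain ⟨⟨⟨U₁, U₂⟩⟩, hU₁, hU₂⟩ := U
  change U₁ ∈ sobolev 2 at hU₁
  change U₂ ∈ sobolev 2 at hU₂
  have hβ : 0 ≤ β := hα.le.trans hαβ
  obtain ⟨w₁₁, ew₁₁, dw₁₁⟩ := exists_expDecay_of_mem_expSpace hW₁₁
  obtain ⟨w₁₂, ew₁₂, dw₁₂⟩ := exists_expDecay_of_mem_expSpace hW₁₂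
  obtain ⟨w₂, ew₂, dw₂⟩ := exists_expDecay_of_mem_expSpace hW₂
  obtain ⟨w₃, ew₃, dw₃⟩ := exists_expDecay_of_mem_expSpace hW₃
  obtain ⟨w₄₁, ew₄₁, dw₄₁⟩ := exists_expDecay_of_mem_expSpace hW₄₁
  obtain ⟨w₄₂, ew₄₂, dw₄₂⟩ := exists_expDecay_of_mem_expSpace hW₄₂
  obtain ⟨a, ea, da⟩ := exists_expDecay_of_mem_expSpace hA.1
  obtain ⟨b, eb, db⟩ := exists_expDecay_of_mem_expSpace hA.2
  obtain ⟨u, u', eu, eu', hu, hu'c, hup, bu, bu'⟩ := exists_rep_of_mem_sobolev_two hU₁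
  obtain ⟨v, v', ev, ev', hv, hv'c, hvp, bv, bv'⟩ := exists_rep_of_mem_sobolev_two hU₂
  have cont : ∀ {f g : ℝ → ℂ}, (∀ x, HasDerivAt f (g x) x) → Continuous f := fun h =>
    continuous_iff_continuousAt.mpr fun x => (h x).continuousAt
  have huc := cont hu
  have hvc := cont hv
  have q₁ : (mulOp W₁₁ U₁ + mulOp W₁₂ (wderiv U₁))
      + (wderiv (wderiv U₂) - ((h₁ ^ 2 / 4 : ℝ) : ℂ) • U₂ + mulOp W₂ U₂) - lam • U₁ = A.fst :=
    congrArg WithLp.fst hU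
  have q₂ : (-wderiv (wderiv U₁) + ((h₁ ^ 2 / 4 : ℝ) : ℂ) • U₁ + mulOp W₃ U₁)
      + (mulOp W₄₁ U₂ + mulOp W₄₂ (wderiv U₂)) - lam • U₂ = A.snd :=
    congrArg WithLp.snd hU
  set m : ℂ := ((h₁ ^ 2 / 4 : ℝ) : ℂ)
  have hu'' : ∀ᵐ x, wderiv (wderiv U₁) x
      = m * u x - lam * v x + (w₃ x * u x + w₄₁ x * v x + w₄₂ x * v' x - b x) := by
    -- The second row is solved for `u''`; below, the first row is solved for `v''`.
    have q : wderiv (wderiv U₁) = m • U₁ - lam • U₂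
        + (mulOp W₃ U₁ + mulOp W₄₁ U₂ + mulOp W₄₂ (wderiv U₂) - A.snd) := by
      rw [← q₂]
      abel
    rw [q]
    filter_upwards [eu, ev, ev', eb, ew₃, ew₄₁, ew₄₂, mulOp_apply hβ hW₃ U₁,
      mulOp_apply hβ hW₄₁ U₂, mulOp_apply hβ hW₄₂ (wderiv U₂),
      Lp.coeFn_add (m • U₁ - lam • U₂)
        (mulOp W₃ U₁ + mulOp W₄₁ U₂ + mulOp W₄₂ (wderiv U₂) - A.snd),
      Lp.coeFn_sub (m • U₁) (lam • U₂), Lp.coeFn_smul m U₁, Lp.coeFn_smul lam U₂,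
      Lp.coeFn_sub (mulOp W₃ U₁ + mulOp W₄₁ U₂ + mulOp W₄₂ (wderiv U₂)) A.snd,
      Lp.coeFn_add (mulOp W₃ U₁ + mulOp W₄₁ U₂) (mulOp W₄₂ (wderiv U₂)),
      Lp.coeFn_add (mulOp W₃ U₁) (mulOp W₄₁ U₂)]
      with x x1 x2 x3 x4 x5 x6 x7 x8 x9 x10 x11 x12 x13 x14 x15 x16 x17
    simp only [x11, x12, x13, x14, x15, x16, x17, Pi.add_apply, Pi.sub_apply, Pi.smul_apply,
      smul_eq_mul, x8, x9, x10, x1, x2, x3, x4, x5, x6, x7]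
  have hv'' : ∀ᵐ x, wderiv (wderiv U₂) x
      = lam * u x + m * v x + (a x - w₂ x * v x - w₁₁ x * u x - w₁₂ x * u' x) := by
    have q : wderiv (wderiv U₂) = lam • U₁ + m • U₂
        + (A.fst - mulOp W₂ U₂ - mulOp W₁₁ U₁ - mulOp W₁₂ (wderiv U₁)) := by
      rw [← q₁]
      abel
    rw [q]
    filter_upwards [eu, ev, eu', ea, ew₂, ew₁₁, ew₁₂, mulOp_apply hβ hW₂ U₂,
      mulOp_apply hβ hW₁₁ U₁, mulOp_apply hβ hW₁₂ (wderiv U₁),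
      Lp.coeFn_add (lam • U₁ + m • U₂)
        (A.fst - mulOp W₂ U₂ - mulOp W₁₁ U₁ - mulOp W₁₂ (wderiv U₁)),
      Lp.coeFn_add (lam • U₁) (m • U₂), Lp.coeFn_smul lam U₁, Lp.coeFn_smul m U₂,
      Lp.coeFn_sub (A.fst - mulOp W₂ U₂ - mulOp W₁₁ U₁) (mulOp W₁₂ (wderiv U₁)),
      Lp.coeFn_sub (A.fst - mulOp W₂ U₂) (mulOp W₁₁ U₁),
      Lp.coeFn_sub A.fst (mulOp W₂ U₂)]
      with x x1 x2 x3 x4 x5 x6 x7 x8 x9 x10 x11 x12 x13 x14 x15 x16 x17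
    simp only [x11, x12, x13, x14, x15, x16, x17, Pi.add_apply, Pi.sub_apply, Pi.smul_apply,
      smul_eq_mul, x8, x9, x10, x1, x2, x3, x4, x5, x6, x7]
  -- Continuity of all coefficients and data makes the right-hand sides continuous, so the a.e.
  -- second derivatives become classical ones.
  have c₁ := (dw₁₁ 0).continuous
  have c₂ := (dw₁₂ 0).continuous
  have c₃ := (dw₂ 0).continuous
  have c₄ := (dw₃ 0).continuous
  have c₅ := (dw₄₁ 0).continuous
  have c₆ := (dw₄₂ 0).continuous
  have c₇ := (da 0).continuous
  have c₈ := (db 0).continuous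
  have hsol := expDecay_of_system hα hk hl hαk hαl (fun n => (dw₁₁ n).mono hαβ)
    (fun n => (dw₁₂ n).mono hαβ) (fun n => (dw₂ n).mono hαβ) (fun n => (dw₃ n).mono hαβ)
    (fun n => (dw₄₁ n).mono hαβ) (fun n => (dw₄₂ n).mono hαβ) da db hu hv
    (hasDerivAt_of_primitive (by fun_prop) hu'' hup)
    (hasDerivAt_of_primitive (by fun_prop) hv'' hvp) bu bv bu' bv'
  exact ⟨u, v, eu, ev, fun n => (hsol n).1, fun n => (hsol n).2.1⟩

theorem zero_mem_expSpaceC2 {α : ℝ} (hα : 0 < α) : (0 : L2C2) ∈ expSpaceC2 α := by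
  have h0 : ∀ n, ExpDecay α n (fun _ => (0 : ℂ)) := fun n => by
    induction n with
    | zero => exact ⟨continuous_const, 0, fun x => by simp⟩
    | succ n ih => exact ⟨⟨0, fun x => by simp⟩, _, fun x => hasDerivAt_const x 0, ih⟩
  have h1 : (0 : L2) ∈ expSpace α := mem_expSpace_of_expDecay hα h0 (Lp.coeFn_zero ℂ 2 volume)
  exact ⟨h1, h1⟩

theorem ExpDecay.contDiff_one {α : ℝ} {f : ℝ → ℂ} (hf : ExpDecay α 1 f) :
    ContDiff ℝ 1 f ∧ ExpBound α (deriv f) := by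
  obtain ⟨-, f', hf', hc, hb⟩ := hf
  have e : deriv f = f' := funext fun x => (hf' x).deriv
  rw [contDiff_one_iff_deriv, e]
  exact ⟨⟨fun x => (hf' x).differentiableAt, hc⟩, hb⟩

/-- The numbers `m ± i lam` have imaginary part `±Re lam` and real part `m ∓ Im lam`. If `Re lam ≠
0` they are not real; otherwise `|Im lam| < m` makes them positive. -/
theorem mem_slitPlane_of_notMem {h₁ : ℝ} {lam : ℂ}
    (hlam : lam ∉ {z : ℂ | ∃ y : ℝ, h₁ ^ 2 / 4 ≤ |y| ∧ z = Complex.I * (y : ℂ)}) :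
    ((h₁ ^ 2 / 4 : ℝ) : ℂ) + Complex.I * lam ∈ Complex.slitPlane ∧
      ((h₁ ^ 2 / 4 : ℝ) : ℂ) - Complex.I * lam ∈ Complex.slitPlane := by
  have key : lam.re = 0 → |lam.im| < h₁ ^ 2 / 4 := fun h => by
    by_contra hc
    exact hlam ⟨lam.im, not_lt.mp hc, by apply Complex.ext <;> simp [h]⟩
  simp only [Complex.mem_slitPlane_iff, Complex.add_re, Complex.sub_re, Complex.add_im,
    Complex.sub_im, Complex.ofReal_re, Complex.ofReal_im, Complex.mul_re, Complex.mul_im,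
    Complex.I_re, Complex.I_im]
  by_cases h : lam.re = 0
  · have := abs_lt.mp (key h)
    exact ⟨Or.inl (by linarith), Or.inl (by linarith)⟩
  · exact ⟨Or.inr (by simpa using h), Or.inr (by simpa using h)⟩

end SystemDecay

theorem proposition3p1 (h₁ : ℝ) (lam : ℂ)
    (hlam : lam ∉ {z : ℂ | ∃ y : ℝ, h₁ ^ 2 / 4 ≤ |y| ∧ z = Complex.I * (y : ℂ)}) :
    ∃ α₀ : ℝ, 0 < α₀ ∧
      ∀ β : ℝ, 0 < β → ∀ W₁₁ W₁₂ W₂ W₃ W₄₁ W₄₂ : SystemDecay.L2,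
        W₁₁ ∈ SystemDecay.expSpace β → W₁₂ ∈ SystemDecay.expSpace β →
        W₂ ∈ SystemDecay.expSpace β → W₃ ∈ SystemDecay.expSpace β →
        W₄₁ ∈ SystemDecay.expSpace β → W₄₂ ∈ SystemDecay.expSpace β →
      ∀ L : SystemDecay.L2C2 →ₗ.[ℂ] SystemDecay.L2C2,
        L = SystemDecay.systemOp h₁ W₁₁ W₁₂ W₂ W₃ W₄₁ W₄₂ →
      ∀ α : ℝ, 0 < α → α ≤ α₀ → α ≤ β →
        -- (i) decay of eigenfunctions
        (∀ U : L.domain, L U = lam • (U : SystemDecay.L2C2) →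
          (∃ u v : ℝ → ℂ, ContDiff ℝ 1 u ∧ ContDiff ℝ 1 v ∧
            (∀ᵐ x, (U : SystemDecay.L2C2).fst x = u x) ∧
            (∀ᵐ x, (U : SystemDecay.L2C2).snd x = v x) ∧
            ∃ C : ℝ, 0 < C ∧ ∀ x : ℝ,
              ‖u x‖ + ‖v x‖ + ‖deriv u x‖ + ‖deriv v x‖ ≤ C * Real.exp (-α * |x|)) ∧
          (U : SystemDecay.L2C2).fst ∈ SystemDecay.expSpace α ∧
          (U : SystemDecay.L2C2).snd ∈ SystemDecay.expSpace α) ∧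
        -- (ii) the resolvent preserves the weighted space
        (lam ∉ SystemDecay.unboundedSpectrum L →
          ∀ A ∈ SystemDecay.expSpaceC2 α,
            ∃ X : L.domain, L X - lam • (X : SystemDecay.L2C2) = A ∧
              (X : SystemDecay.L2C2) ∈ SystemDecay.expSpaceC2 α ∧
              ∀ Y : L.domain, L Y - lam • (Y : SystemDecay.L2C2) = A → Y = X) := by

  obtain ⟨hs₁, hs₂⟩ := SystemDecay.mem_slitPlane_of_notMem hlam
  obtain ⟨k, hk, hk0⟩ := SystemDecay.exists_sq_eq_re_pos hs₁
  obtain ⟨l, hl, hl0⟩ := SystemDecay.exists_sq_eq_re_pos hs₂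
  -- Halving keeps `α < Re k` and `α < Re l` strict even when `α = α₀`. The roots depend only on
  -- `h₁` and `lam`.
  refine ⟨min k.re l.re / 2, half_pos (lt_min hk0 hl0), ?_⟩
  rintro β - W₁₁ W₁₂ W₂ W₃ W₄₁ W₄₂ hW₁₁ hW₁₂ hW₂ hW₃ hW₄₁ hW₄₂ L rfl α hα hα₀ hαβ
  have hmin : α < min k.re l.re := hα₀.trans_lt (half_lt_self (lt_min hk0 hl0))
  have key := fun (A : SystemDecay.L2C2) (hA : A ∈ SystemDecay.expSpaceC2 α) =>
    SystemDecay.exists_expDecay_of_systemOp_sub_smul hα hk hl (lt_min_iff.mp hmin).1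
      (lt_min_iff.mp hmin).2 hαβ hW₁₁ hW₁₂ hW₂ hW₃ hW₄₁ hW₄₂ hA
  refine ⟨fun U hU => ?_, fun hspec A hA => ?_⟩
  · obtain ⟨u, v, eu, ev, du, dv⟩ := key 0 (SystemDecay.zero_mem_expSpaceC2 hα) U
      (sub_eq_zero.mpr hU)
    obtain ⟨cu, Cu', hu'⟩ := (du 1).contDiff_one
    obtain ⟨cv, Cv', hv'⟩ := (dv 1).contDiff_one
    obtain ⟨Cu, hu⟩ := (du 0).expBound
    obtain ⟨Cv, hv⟩ := (dv 0).expBound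
    -- The `max` with `1` secures a positive constant, since the sum vanishes when all four bounds
    -- are zero.
    refine ⟨⟨u, v, cu, cv, eu, ev, max 1 (Cu + Cv + Cu' + Cv'), by positivity, fun x => ?_⟩,
      SystemDecay.mem_expSpace_of_expDecay hα du eu, SystemDecay.mem_expSpace_of_expDecay hα dv ev⟩
    refine le_trans ?_ (mul_le_mul_of_nonneg_right (le_max_right _ _) (Real.exp_pos _).le)
    rw [add_mul, add_mul, add_mul]
    exact add_le_add (add_le_add (add_le_add (hu x) (hv x)) (hu' x)) (hv' x)
  · obtain ⟨hbij, -⟩ := not_not.mp hspec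
    obtain ⟨X, hX⟩ := hbij.2 A
    obtain ⟨u, v, eu, ev, du, dv⟩ := key A hA X hX
    exact ⟨X, hX, ⟨SystemDecay.mem_expSpace_of_expDecay hα du eu,
      SystemDecay.mem_expSpace_of_expDecay hα dv ev⟩, fun Y hY => hbij.1 (hY.trans hX.symm)⟩
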